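/- A grounded $L$-shape is a polygonal line in the plane consisting of a vertical segment of positive length that goes up from a point of a fixed horizontal line (the ground line) to a bend, followed by a horizontal segment of positive length that goes from the bend either to the right (the $L$-shape turns clockwise) or to the left (it turns anticlockwise). It is square if its two segments have the same length. A representation of a graph $G$ by grounded $L$-shapes assigns to each vertex an $L$-shape grounded on a common ground line so that two distinct vertices are adjacent if and only if their $L$-shapes intersect. The representation is 1-sided if all its $L$-shapes turn clockwise or all turn anticlockwise, and 2-sided otherwise; it is in general position if no two segments of different $L$-shapes lie on the same horizontal or vertical line. Theorem. There is a graph that admits a representation by 2-sided grounded square $L$-shapes but no representation by 1-sided grounded $L$-shapes. Explicitly, let $G$ be the graph of Jelínek and Töpfer with the 96 vertices $y_1,\dots,y_{80},x_1,\dots,x_{16}$ and exactly the following edges: the edges of the cycle $y_1y_2\cdots y_{80}y_1$; the edges $x_iy_{5i}$ for $1\le i\le 16$; and, inside four gadgets, the edges $$x_1x_4,\ x_1x_2,\ x_2x_3;\qquad x_5x_8,\ x_7x_8,\ x_6x_7;\qquad x_9x_{12},\ x_9x_{10},\ x_{10}x_{11};\qquad x_{13}x_{16},\ x_{15}x_{16},\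 x_{14}x_{15}.$$ Then $G$ has a 2-sided representation by grounded square $L$-shapes, which can moreover be chosen in general position, and $G$ has no 1-sided representation by grounded $L$-shapes (in general position or not). -/

import Mathlib

/-- An L-shape grounded on the horizontal axis `y = 0`: an axis-aligned polygonal line with one bend,
which goes vertically from its ground point `(foot, 0)` up to its bend `(foot, height)`, and then
horizontally to its free endpoint `(foot + arm, height)`. -/
structure GroundedL where
  /-- abscissa of the endpoint on the ground line -/
  foot : ℝ
  /-- length of the vertical segment -/
  height : ℝ
  /-- signed length of the horizontal segment -/
  arm : ℝ
  height_pos : 0 < height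
  arm_ne_zero : arm ≠ 0

namespace GroundedL

/-- The set of points of the plane that lie on the L-shape. -/
def toSet (L : GroundedL) : Set (ℝ × ℝ) :=
  segment ℝ (L.foot, 0) (L.foot, L.height) ∪
    segment ℝ (L.foot, L.height) (L.foot + L.arm, L.height)

/-- Followed from the ground upwards, the L-shape turns clockwise at its bend (to the right). -/
def TurnsClockwise (L : GroundedL) : Prop := 0 < L.arm

/-- Followed from the ground upwards, the L-shape turns anticlockwise at its bend (to the left). -/
def TurnsAnticlockwise (L : GroundedL) : Prop := L.arm < 0

/-- The horizontal and the vertical segment have the same length. -/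
def IsSquare (L : GroundedL) : Prop := |L.arm| = L.height

end GroundedL

/-- The family `R` of grounded L-shapes is an intersection representation of `G`: distinct vertices
are adjacent if and only if their L-shapes intersect. -/
def IsGroundedLRepresentation {V : Type*} (G : SimpleGraph V) (R : V → GroundedL) : Prop :=
  ∀ u v : V, u ≠ v → (G.Adj u v ↔ ((R u).toSet ∩ (R v).toSet).Nonempty)

/-- All the L-shapes turn clockwise, or all turn anticlockwise. -/
def IsOneSided {V : Type*} (R : V → GroundedL) : Prop :=
  (∀ v, (R v).TurnsClockwise) ∨ (∀ v, (R v).TurnsAnticlockwise)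

/-- A family of L-shapes is two-sided if it is not one-sided. -/
def IsTwoSided {V : Type*} (R : V → GroundedL) : Prop := ¬ IsOneSided R

/-- No two segments of different L-shapes lie on the same vertical or horizontal line. -/
def InGeneralPosition {V : Type*} (R : V → GroundedL) : Prop :=
  ∀ u v : V, u ≠ v → (R u).foot ≠ (R v).foot ∧ (R u).height ≠ (R v).height

/-- The edges `x_a x_b` inside the four gadgets `{x_1, …, x_4}`, `{x_5, …, x_8}`,
`{x_9, …, x_12}`, `{x_13, …, x_16}`, as pairs of indices `(a, b)`. -/
def gadgetEdges : List (ℕ × ℕ) :=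
  [(1, 4), (1, 2), (2, 3),
   (5, 8), (7, 8), (6, 7),
   (9, 12), (9, 10), (10, 11),
   (13, 16), (15, 16), (14, 15)]

/-- One orientation of each edge of the graph `jelinekTopferGraph`: `Sum.inl j` is the cycle vertex
`y_{j+1}` and `Sum.inr i` is the gadget vertex `x_{i+1}`. -/
def jelinekTopferRel : Fin 80 ⊕ Fin 16 → Fin 80 ⊕ Fin 16 → Prop
  -- the cycle `y_1, …, y_80`; addition in `Fin 80` is modulo 80
  | Sum.inl j, Sum.inl k => k = j + 1
  -- `x_a` is adjacent to `y_b` exactly when `b = 5 a`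
  | Sum.inr i, Sum.inl j => (j : ℕ) + 1 = 5 * ((i : ℕ) + 1)
  | Sum.inr i, Sum.inr k => ((i : ℕ) + 1, (k : ℕ) + 1) ∈ gadgetEdges
  | Sum.inl _, Sum.inr _ => False

/-- The graph of Jelínek and Töpfer: an 80-cycle `y_1, …, y_80` and four gadgets with the vertices
`x_1, …, x_16`, where `x_i` is attached to `y_{5 i}`. -/
def jelinekTopferGraph : SimpleGraph (Fin 80 ⊕ Fin 16) :=
  SimpleGraph.fromRel jelinekTopferRel

/-! ### Geometry of grounded L-shapes -/

namespace GroundedL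

theorem mem_toSet_iff (L : GroundedL) (p : ℝ × ℝ) :
    p ∈ L.toSet ↔ (p.1 = L.foot ∧ 0 ≤ p.2 ∧ p.2 ≤ L.height) ∨
      (p.1 ∈ Set.uIcc L.foot (L.foot + L.arm) ∧ p.2 = L.height) := by
  obtain ⟨x, y⟩ := p
  simp only [toSet, ← Prod.image_mk_segment_left, ← Prod.image_mk_segment_right,
    segment_eq_uIcc, Set.uIcc_of_le L.height_pos.le, Set.mem_union, Set.mem_image, Prod.mk.injEq,
    Set.mem_Icc]
  constructor
  · rintro (⟨t, ⟨h0, h1⟩, rfl, rfl⟩ | ⟨t, ht, rfl, rfl⟩)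
    · exact Or.inl ⟨rfl, h0, h1⟩
    · exact Or.inr ⟨ht, rfl⟩
  · rintro (⟨rfl, h0, h1⟩ | ⟨h, rfl⟩)
    · exact Or.inl ⟨y, ⟨h0, h1⟩, rfl, rfl⟩
    · exact Or.inr ⟨x, h, rfl, rfl⟩

/-- The horizontal segment of `L` meets the vertical segment of `M`. -/
def Hits (L M : GroundedL) : Prop :=
  L.height ≤ M.height ∧ M.foot ∈ Set.uIcc L.foot (L.foot + L.arm)

theorem Hits.inter_nonempty {L M : GroundedL} (h : L.Hits M) : (L.toSet ∩ M.toSet).Nonempty :=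
  ⟨(M.foot, L.height), (L.mem_toSet_iff _).2 (Or.inr ⟨h.2, rfl⟩),
    (M.mem_toSet_iff _).2 (Or.inl ⟨rfl, L.height_pos.le, h.1⟩)⟩

theorem inter_nonempty_iff {L M : GroundedL}
    (h : L.height ≠ M.height ∨ (L.TurnsClockwise ∧ M.TurnsClockwise)) :
    (L.toSet ∩ M.toSet).Nonempty ↔ L.Hits M ∨ M.Hits L := by
  constructor
  · rintro ⟨p, hL, hM⟩
    rw [mem_toSet_iff] at hL hM
    rcases hL with ⟨hL, hL0, hL1⟩ | ⟨hL, hL1⟩ <;> rcases hM with ⟨hM, hM0, hM1⟩ | ⟨hM, hM1⟩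
    · have hf : L.foot = M.foot := hL.symm.trans hM
      rcases le_total L.height M.height with h' | h'
      · exact Or.inl ⟨h', hf ▸ Set.left_mem_uIcc⟩
      · exact Or.inr ⟨h', hf ▸ Set.left_mem_uIcc⟩
    · exact Or.inr ⟨hM1 ▸ hL1, hL ▸ hM⟩
    · exact Or.inl ⟨hL1 ▸ hM1, hM ▸ hL⟩
    · have hh : L.height = M.height := hL1.symm.trans hM1
      obtain ⟨hLr, hMr⟩ := h.resolve_left (not_not.2 hh)
      unfold TurnsClockwise at hLr hMr
      rw [Set.uIcc_of_le (by linarith), Set.mem_Icc] at hL hM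
      unfold Hits
      rw [Set.uIcc_of_le (by linarith), Set.uIcc_of_le (by linarith), Set.mem_Icc, Set.mem_Icc]
      rcases le_total L.foot M.foot with h' | h'
      · exact Or.inl ⟨hh.le, h', hM.1.trans hL.2⟩
      · exact Or.inr ⟨hh.ge, h', hL.1.trans hM.2⟩
  · rintro (h | h)
    · exact h.inter_nonempty
    · exact Set.inter_comm _ _ ▸ h.inter_nonempty

/-- Reflection of an L-shape in the vertical axis. -/
def mirror (L : GroundedL) : GroundedL :=
  ⟨-L.foot, L.height, -L.arm, L.height_pos, neg_ne_zero.2 L.arm_ne_zero⟩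

theorem mem_mirror_toSet_iff (L : GroundedL) (p : ℝ × ℝ) :
    p ∈ L.mirror.toSet ↔ (-p.1, p.2) ∈ L.toSet := by
  simp only [mem_toSet_iff, mirror, Set.mem_uIcc]
  constructor
  · rintro (⟨h, h'⟩ | ⟨h | h, h'⟩)
    · exact Or.inl ⟨by linarith, h'⟩
    · exact Or.inr ⟨Or.inr ⟨by linarith, by linarith⟩, h'⟩
    · exact Or.inr ⟨Or.inl ⟨by linarith, by linarith⟩, h'⟩
  · rintro (⟨h, h'⟩ | ⟨h | h, h'⟩)
    · exact Or.inl ⟨by linarith, h'⟩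
    · exact Or.inr ⟨Or.inr ⟨by linarith, by linarith⟩, h'⟩
    · exact Or.inr ⟨Or.inl ⟨by linarith, by linarith⟩, h'⟩

theorem mirror_inter_nonempty {L M : GroundedL} (h : (L.toSet ∩ M.toSet).Nonempty) :
    (L.mirror.toSet ∩ M.mirror.toSet).Nonempty := by
  obtain ⟨p, hL, hM⟩ := h
  refine ⟨(-p.1, p.2), ?_, ?_⟩ <;> simpa [mem_mirror_toSet_iff]

theorem mirror_mirror (L : GroundedL) : L.mirror.mirror = L := by
  simp [mirror]

theorem mirror_inter_nonempty_iff {L M : GroundedL} :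
    (L.mirror.toSet ∩ M.mirror.toSet).Nonempty ↔ (L.toSet ∩ M.toSet).Nonempty :=
  ⟨fun h => by simpa only [mirror_mirror] using mirror_inter_nonempty h, mirror_inter_nonempty⟩

end GroundedL

/-! ### Vertex orders of 1-sided representations -/

/-- A linear order of the vertices without the two four-vertex patterns that do not occur in
the left-to-right order of a representation by L-shapes turning clockwise. -/
structure IsGroundedLOrder {V : Type*} [LinearOrder V] (G : SimpleGraph V) : Prop where
  adj_of_cross : ∀ ⦃a b c d : V⦄, a < b → b < c → c < d → G.Adj a c → G.Adj b d →
    G.Adj a b ∨ G.Adj b c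
  adj_of_nest : ∀ ⦃a b c d : V⦄, a < b → b < c → c < d → G.Adj a b → G.Adj b c → G.Adj a d →
    G.Adj a c

theorem exists_isGroundedLOrder {V : Type*} [Countable V] {G : SimpleGraph V} {R : V → GroundedL}
    (hR : IsGroundedLRepresentation G R) (hcw : ∀ v, (R v).TurnsClockwise) :
    ∃ _ : LinearOrder V, IsGroundedLOrder G := by
  obtain ⟨e, he⟩ := exists_injective_nat V
  let κ : V → ℝ ×ₗ ℝ ×ₗ ℕ := fun v => toLex ((R v).foot, toLex ((R v).height, e v))
  have hκ : Function.Injective κ := by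
    intro u v h
    simp only [κ, EmbeddingLike.apply_eq_iff_eq, Prod.mk.injEq] at h
    exact he h.2.2
  let ord : LinearOrder V := LinearOrder.lift' κ hκ
  have hlt : ∀ u v : V, u < v → (R u).foot < (R v).foot ∨
      ((R u).foot = (R v).foot ∧ (R u).height ≤ (R v).height) := by
    intro u v h
    have h' : κ u < κ v := h
    simp only [κ, Prod.Lex.toLex_lt_toLex] at h'
    rcases h' with h' | ⟨h1, h2 | ⟨h2, -⟩⟩
    · exact Or.inl h'
    · exact Or.inr ⟨h1, h2.le⟩
    · exact Or.inr ⟨h1, h2.le⟩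
  have hfoot : ∀ {u v : V}, u < v → (R u).foot ≤ (R v).foot := fun {u v} h =>
    (hlt u v h).elim le_of_lt fun h => h.1.le
  have hadj : ∀ {u v : V}, u < v → (G.Adj u v ↔
      (R u).height ≤ (R v).height ∧ (R v).foot ≤ (R u).foot + (R u).arm) := by
    intro u v h
    rw [hR u v h.ne, GroundedL.inter_nonempty_iff (Or.inr ⟨hcw u, hcw v⟩)]
    have hu : 0 < (R u).arm := hcw u
    have hv : 0 < (R v).arm := hcw v
    unfold GroundedL.Hits
    rw [Set.uIcc_of_le (by linarith), Set.uIcc_of_le (by linarith), Set.mem_Icc, Set.mem_Icc]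
    constructor
    · rintro (⟨h1, -, h2⟩ | ⟨h1, h2, -⟩)
      · exact ⟨h1, h2⟩
      · rcases hlt u v h with h3 | ⟨h3, h4⟩
        · linarith
        · exact ⟨h4, by linarith⟩
    · rintro ⟨h1, h2⟩
      exact Or.inl ⟨h1, hfoot h, h2⟩
  refine ⟨ord, ?_, ?_⟩
  · intro a b c d hab hbc hcd hac hbd
    rw [hadj (hab.trans hbc)] at hac
    rw [hadj (hbc.trans hcd)] at hbd
    rw [hadj hab, hadj hbc]
    have h1 := hfoot hbc
    have h2 := hfoot hcd
    rcases le_or_gt (R a).height (R b).height with h | h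
    · exact Or.inl ⟨h, by linarith⟩
    · exact Or.inr ⟨by linarith, by linarith⟩
  · intro a b c d hab hbc hcd h1 h2 h3
    rw [hadj hab] at h1
    rw [hadj hbc] at h2
    rw [hadj (hab.trans (hbc.trans hcd))] at h3
    rw [hadj (hab.trans hbc)]
    have := hfoot hcd
    exact ⟨by linarith, by linarith⟩

namespace SimpleGraph

variable {V : Type*} {G : SimpleGraph V}

/-- A set of vertices that induces a connected subgraph, expressed through cuts. -/
def IsLinked (G : SimpleGraph V) (S : Set V) : Prop :=
  ∀ A : Set V, ∀ s ∈ S, s ∈ A → ∀ t ∈ S, t ∉ A → ∃ u ∈ S, ∃ v ∈ S, u ∈ A ∧ v ∉ A ∧ G.Adj u v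

/-- Disjoint sets of vertices without an edge between them. -/
def IsAnticomplete (G : SimpleGraph V) (S T : Set V) : Prop :=
  ∀ s ∈ S, ∀ t ∈ T, s ≠ t ∧ ¬ G.Adj s t

theorem IsAnticomplete.symm {S T : Set V} (h : G.IsAnticomplete S T) : G.IsAnticomplete T S :=
  fun t ht s hs => ⟨(h s hs t ht).1.symm, fun h' => (h s hs t ht).2 h'.symm⟩

theorem isLinked_singleton (v : V) : G.IsLinked {v} := by
  rintro A s rfl hs t rfl ht
  exact absurd hs ht

theorem IsLinked.insert_vertex {S : Set V} (h : G.IsLinked S) {u v : V} (hv : v ∈ S)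
    (huv : u = v ∨ G.Adj u v) : G.IsLinked (insert u S) := by
  rcases huv with rfl | huv
  · rwa [Set.insert_eq_of_mem hv]
  have lift : ∀ A : Set V, ∀ s ∈ S, s ∈ A → ∀ t ∈ S, t ∉ A →
      ∃ a ∈ insert u S, ∃ b ∈ insert u S, a ∈ A ∧ b ∉ A ∧ G.Adj a b := by
    intro A s hs hsA t ht htA
    obtain ⟨a, ha, b, hb, h'⟩ := h A s hs hsA t ht htA
    exact ⟨a, Or.inr ha, b, Or.inr hb, h'⟩
  intro A s hs hsA t ht htA
  by_cases hu : u ∈ A <;> by_cases hvA : v ∈ A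
  · refine lift A v hv hvA t (ht.resolve_left ?_) htA
    rintro rfl; exact htA hu
  · exact ⟨u, Or.inl rfl, v, Or.inr hv, hu, hvA, huv⟩
  · exact ⟨v, Or.inr hv, u, Or.inl rfl, hvA, hu, huv.symm⟩
  · refine lift A s (hs.resolve_left ?_) hsA v hv hvA
    rintro rfl; exact hu hsA

theorem isLinked_image_Icc {y : ℕ → V} (hy : ∀ n, G.Adj (y n) (y (n + 1))) {i j : ℕ}
    (hij : i ≤ j) : G.IsLinked (y '' Set.Icc i j) := by
  induction j, hij using Nat.le_induction with
  | base => simpa using isLinked_singleton (y i)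
  | succ j hij ih =>
    have h : Set.Icc i (j + 1) = insert (j + 1) (Set.Icc i j) := by ext; simp; omega
    rw [h, Set.image_insert_eq]
    exact ih.insert_vertex ⟨j, ⟨hij, le_rfl⟩, rfl⟩ (Or.inr (hy j).symm)

end SimpleGraph

namespace IsGroundedLOrder

open SimpleGraph

variable {V : Type*} [LinearOrder V] {G : SimpleGraph V}

theorem mem_Ioo_of_isLinked (hG : IsGroundedLOrder G) {T : Set V} (hT : G.IsLinked T) {u v t : V}
    (huv : G.Adj u v) (h : G.IsAnticomplete {u, v} T) (ht : t ∈ T) (htuv : t ∈ Set.Ioo u v)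
    {t' : V} (ht' : t' ∈ T) : t' ∈ Set.Ioo u v := by
  by_contra hn
  obtain ⟨a, ha, b, hb, ⟨hua, hav⟩, hbn, hab⟩ := hT _ t ht htuv t' ht' hn
  have hbu := h u (Or.inl rfl) b hb
  have hbv := h v (Or.inr rfl) b hb
  have hau := h u (Or.inl rfl) a ha
  have hav' := h v (Or.inr rfl) a ha
  rcases lt_or_gt_of_ne hbu.1 with h1 | h1
  · rcases lt_or_gt_of_ne hbv.1 with h2 | h2
    · rcases hG.adj_of_cross hua hav h2 huv hab with h3 | h3
      · exact hau.2 h3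
      · exact hav'.2 h3.symm
    · exact hbn ⟨h1, h2⟩
  · rcases hG.adj_of_cross h1 hua hav hab.symm huv with h3 | h3
    · exact hbu.2 h3.symm
    · exact hau.2 h3

theorem not_alternating (hG : IsGroundedLOrder G) {S T : Set V} (hS : G.IsLinked S)
    (hT : G.IsLinked T) (hST : G.IsAnticomplete S T) {a b c d : V} (ha : a ∈ S) (hb : b ∈ T)
    (hc : c ∈ S) (hd : d ∈ T) (hab : a < b) (hbc : b < c) (hcd : c < d) : False := by
  obtain ⟨t, ht, t', ht', htc, htc', htt'⟩ := hT {x | x < c} b hb hbc d hd (not_lt.2 hcd.le)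
  have hS' := fun s (hs : s ∈ S) => hG.mem_Ioo_of_isLinked hS htt'
    (fun x hx s hs => hST.symm x (by rcases hx with rfl | rfl <;> assumption) s hs) hc
    ⟨htc, lt_of_le_of_ne (not_lt.1 htc') (hST c hc t' ht').1⟩ hs
  obtain ⟨s, hs, s', hs', hsb, hsb', hss'⟩ := hS {x | x < b} a ha hab c hc (not_lt.2 hbc.le)
  have hT' := hG.mem_Ioo_of_isLinked hT hss'
    (fun x hx t ht => hST x (by rcases hx with rfl | rfl <;> assumption) t ht) hb
    ⟨hsb, lt_of_le_of_ne (not_lt.1 hsb') (hST.symm b hb s' hs').1⟩ ht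
  exact lt_asymm hT'.1 (hS' s hs).1

end IsGroundedLOrder

/-! ### The cyclic order of the vertices around a cycle -/

/-- Three elements of a linear order in counterclockwise position, when the order is closed up to
a cycle. -/
def Cyc {V : Type*} [LT V] (a b c : V) : Prop :=
  (a < b ∧ b < c) ∨ (b < c ∧ c < a) ∨ (c < a ∧ a < b)

section Cyc

variable {V : Type*} [LinearOrder V]

theorem cyc_rotate {a b c : V} : Cyc a b c ↔ Cyc b c a := by
  unfold Cyc; tauto

theorem not_cyc_iff {a b c : V} (hab : a ≠ b) (hbc : b ≠ c) (hac : a ≠ c) :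
    ¬ Cyc a b c ↔ Cyc c b a := by
  unfold Cyc; grind

theorem lt_or_lt_of_cyc {p q r s : V} (h₁ : Cyc p q r) (h₂ : Cyc p r s) : p < q ∨ r < s := by
  unfold Cyc at *; grind

theorem lt_lt_lt_of_cyc {z₀ z₁ z₂ z₃ z₄ x₀ x₁ x₂ x₃ : V} (h : z₀ < z₄)
    (h₁ : Cyc z₀ z₁ z₄) (h₂ : Cyc z₁ z₂ z₄) (h₃ : Cyc z₂ z₃ z₄)
    (k₀ : Cyc z₀ x₀ z₁) (k₁ : Cyc z₁ x₁ z₂) (k₂ : Cyc z₂ x₂ z₃) (k₃ : Cyc z₃ x₃ z₄) :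
    x₀ < x₁ ∧ x₁ < x₂ ∧ x₂ < x₃ := by
  have key : ∀ {a b c : V}, a < c → Cyc a b c → a < b ∧ b < c := by
    intro a b c h h'
    rcases h' with h' | h' | h'
    · exact h'
    · exact absurd h (lt_asymm h'.2)
    · exact absurd h (lt_asymm h'.1)
  have l₁ := key h h₁
  have l₂ := key l₁.2 h₂
  have l₃ := key l₂.2 h₃
  have m₀ := key l₁.1 k₀
  have m₁ := key l₂.1 k₁
  have m₂ := key l₃.1 k₂
  have m₃ := key l₃.2 k₃
  exact ⟨m₀.2.trans m₁.1, m₁.2.trans m₂.1, m₂.2.trans m₃.1⟩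

end Cyc

/-- An induced cycle of length `N`, parametrized periodically by the natural numbers. -/
structure IsInducedCycle {V : Type*} (G : SimpleGraph V) (N : ℕ) (y : ℕ → V) : Prop where
  periodic : ∀ n, y (n + N) = y n
  adj : ∀ n, G.Adj (y n) (y (n + 1))
  far : ∀ m n, m + 2 ≤ n → n + 2 ≤ m + N → y m ≠ y n ∧ ¬ G.Adj (y m) (y n)

/-- The vertex `a` lies at position `i` of the cycle `y` or is a pendant vertex attached there. -/
structure IsAttached {V : Type*} (G : SimpleGraph V) (N : ℕ) (y : ℕ → V) (a : V) (i : ℕ) :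
    Prop where
  eq_or_adj : a = y i ∨ G.Adj a (y i)
  far : ∀ m, i + 2 ≤ m → m + 2 ≤ i + N → a ≠ y m ∧ ¬ G.Adj a (y m)

namespace IsGroundedLOrder

open SimpleGraph

variable {V : Type*} [LinearOrder V] {G : SimpleGraph V}

theorem cyc_of_isAnticomplete (hG : IsGroundedLOrder G) {S T : Set V} (hS : G.IsLinked S)
    (hT : G.IsLinked T) (hST : G.IsAnticomplete S T) {p q r u : V} (hp : p ∈ S) (hq : q ∈ S)
    (hr : r ∈ T) (hu : u ∈ T) (hpq : p ≠ q) (h : Cyc p q r) : Cyc p q u := by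
  by_contra hn
  rw [not_cyc_iff hpq (hST q hq u hu).1 (hST p hp u hu).1] at hn
  have h₁ := fun {s t s' t' : V} => hG.not_alternating (a := s) (b := t) (c := s') (d := t') hS hT hST
  have h₂ := fun {s t s' t' : V} =>
    hG.not_alternating (a := s) (b := t) (c := s') (d := t') hT hS hST.symm
  rcases h with ⟨i, j⟩ | ⟨i, j⟩ | ⟨i, j⟩ <;> rcases hn with ⟨k, l⟩ | ⟨k, l⟩ | ⟨k, l⟩ <;>
  first
  | order
  | exact h₁ hp hu hq hr (by assumption) (by assumption) (by assumption)
  | exact h₁ hq hr hp hu (by assumption) (by assumption) (by assumption)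
  | exact h₂ hr hp hu hq (by assumption) (by assumption) (by assumption)
  | exact h₂ hu hq hr hp (by assumption) (by assumption) (by assumption)

theorem cyc_iff_of_isAnticomplete (hG : IsGroundedLOrder G) {S T : Set V} (hS : G.IsLinked S)
    (hT : G.IsLinked T) (hST : G.IsAnticomplete S T) {p q r u : V} (hp : p ∈ S) (hq : q ∈ S)
    (hr : r ∈ T) (hu : u ∈ T) (hpq : p ≠ q) : Cyc p q r ↔ Cyc p q u :=
  ⟨hG.cyc_of_isAnticomplete hS hT hST hp hq hr hu hpq,
    hG.cyc_of_isAnticomplete hS hT hST hp hq hu hr hpq⟩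

theorem cyc_iff (hG : IsGroundedLOrder G) {N : ℕ} {y : ℕ → V} (hy : IsInducedCycle G N y)
    {a : V} {i j k l : ℕ} (ha : IsAttached G N y a i) (hij : i + 2 ≤ j) (hjk : j + 2 ≤ k)
    (hkl : k + 2 ≤ l) (hli : l + 2 ≤ i + N) :
    (Cyc a (y j) (y k) ↔ Cyc (y j) (y k) (y l)) ∧ (Cyc a (y j) (y l) ↔ Cyc (y j) (y k) (y l)) ∧
      (Cyc a (y k) (y l) ↔ Cyc (y j) (y k) (y l)) := by
  have mem : ∀ {p q n : ℕ}, p ≤ n → n ≤ q → y n ∈ y '' Set.Icc p q := fun h h' =>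
    ⟨_, ⟨h, h'⟩, rfl⟩
  have L₁ : G.IsLinked (insert a (y '' Set.Icc i j)) :=
    (isLinked_image_Icc hy.adj (by omega)).insert_vertex (mem le_rfl (by omega)) ha.eq_or_adj
  have L₂ : G.IsLinked (y '' Set.Icc k l) := isLinked_image_Icc hy.adj (by omega)
  have L₃ : G.IsLinked (y '' Set.Icc j k) := isLinked_image_Icc hy.adj (by omega)
  have L₄ : G.IsLinked (insert a (y '' Set.Icc l (i + N))) :=
    (isLinked_image_Icc hy.adj (by omega)).insert_vertex (mem (by omega) le_rfl)
      (by rw [hy.periodic]; exact ha.eq_or_adj)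
  have A₁ : G.IsAnticomplete (insert a (y '' Set.Icc i j)) (y '' Set.Icc k l) := by
    rintro s (rfl | ⟨m, ⟨hm, hm'⟩, rfl⟩) _ ⟨n, ⟨hn, hn'⟩, rfl⟩
    · exact ha.far n (by omega) (by omega)
    · exact hy.far m n (by omega) (by omega)
  have A₂ : G.IsAnticomplete (y '' Set.Icc j k) (insert a (y '' Set.Icc l (i + N))) := by
    rintro _ ⟨n, ⟨hn, hn'⟩, rfl⟩ s (rfl | ⟨m, ⟨hm, hm'⟩, rfl⟩)
    · exact ⟨(ha.far n (by omega) (by omega)).1.symm,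
        fun h => (ha.far n (by omega) (by omega)).2 h.symm⟩
    · exact hy.far n m (by omega) (by omega)
  have e₁ : Cyc a (y j) (y k) ↔ Cyc a (y j) (y l) :=
    hG.cyc_iff_of_isAnticomplete L₁ L₂ A₁ (Or.inl rfl) (Or.inr (mem (by omega) le_rfl))
      (mem le_rfl (by omega)) (mem (by omega) le_rfl) (ha.far j (by omega) (by omega)).1
  have e₂ : Cyc (y k) (y l) a ↔ Cyc (y k) (y l) (y j) :=
    hG.cyc_iff_of_isAnticomplete L₂ L₁ A₁.symm (mem le_rfl (by omega)) (mem (by omega) le_rfl)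
      (Or.inl rfl) (Or.inr (mem (by omega) le_rfl)) (hy.far k l (by omega) (by omega)).1
  have e₃ : Cyc (y j) (y k) a ↔ Cyc (y j) (y k) (y l) :=
    hG.cyc_iff_of_isAnticomplete L₃ L₄ A₂ (mem le_rfl (by omega)) (mem (by omega) le_rfl)
      (Or.inl rfl) (Or.inr (mem le_rfl (by omega))) (hy.far j k (by omega) (by omega)).1
  have e₄ := cyc_rotate.trans e₃
  exact ⟨e₄, e₁.symm.trans e₄, cyc_rotate.trans (e₂.trans cyc_rotate.symm)⟩

theorem cyc_iff_base (hG : IsGroundedLOrder G) {N : ℕ} {y : ℕ → V} (hy : IsInducedCycle G N y)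
    {p q r i j k : ℕ} (hpq : p + 2 ≤ q) (hqr : q + 2 ≤ r) (hij : i + 2 ≤ j) (hjk : j + 2 ≤ k)
    (hi : i = p ∨ p + 2 ≤ i) (hj : j = q ∨ q + 2 ≤ j) (hk : k = r ∨ r + 2 ≤ k)
    (hrp : r + 2 ≤ p + N) (hkp : k + 2 ≤ p + N) :
    Cyc (y i) (y j) (y k) ↔ Cyc (y p) (y q) (y r) := by
  have att : ∀ n, IsAttached G N y (y n) n := fun n => ⟨Or.inl rfl, fun m => hy.far n m⟩
  have e₁ : Cyc (y i) (y j) (y k) ↔ Cyc (y p) (y j) (y k) := by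
    rcases hi with rfl | hi
    · rfl
    · exact (hG.cyc_iff hy (att p) hi hij hjk hkp).2.2.symm
  have e₂ : Cyc (y p) (y j) (y k) ↔ Cyc (y p) (y q) (y k) := by
    rcases hj with rfl | hj
    · rfl
    · have := hG.cyc_iff hy (att p) hpq hj hjk hkp
      exact this.2.2.trans this.2.1.symm
  have e₃ : Cyc (y p) (y q) (y k) ↔ Cyc (y p) (y q) (y r) := by
    rcases hk with rfl | hk
    · rfl
    · have := hG.cyc_iff hy (att p) hpq hqr hk hkp
      exact this.2.1.trans this.1.symm
  exact e₁.trans (e₂.trans e₃)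

end IsGroundedLOrder
namespace IsGroundedLOrder

open SimpleGraph

/-- No order of a 1-sided representation is compatible with an induced 80-cycle that has four
gadgets attached to it, with alternating orientations. -/
theorem false_of_gadgets {V : Type*} [LinearOrder V] {G : SimpleGraph V} (hG : IsGroundedLOrder G)
    {y x : ℕ → V} (hy : IsInducedCycle G 80 y) (hx : ∀ i < 16, IsAttached G 80 y (x i) (5 * i + 4))
    (hodd : ∀ i ∈ ({0, 8} : Set ℕ), G.Adj (x i) (x (i + 1)) ∧ G.Adj (x (i + 1)) (x (i + 2)) ∧
      G.Adj (x i) (x (i + 3)) ∧ ¬ G.Adj (x i) (x (i + 2)))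
    (heven : ∀ i ∈ ({4, 12} : Set ℕ), G.Adj (x (i + 3)) (x (i + 2)) ∧
      G.Adj (x (i + 2)) (x (i + 1)) ∧ G.Adj (x (i + 3)) (x i) ∧ ¬ G.Adj (x (i + 3)) (x (i + 1))) :
    False := by
  obtain ⟨z, hz⟩ : ∃ z : ℕ → V, z = fun i => y (5 * i + 2) := ⟨_, rfl⟩
  have z16 : z 16 = z 0 := by
    subst hz; exact hy.periodic 2
  have zne : ∀ {i j : ℕ}, i < j → j < i + 16 → z i ≠ z j := by
    intro i j h h'
    subst hz
    exact (hy.far _ _ (by omega) (by omega)).1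
  have xzne : ∀ {i j : ℕ}, i < 16 → i < j → j ≤ i + 16 → x i ≠ z j := by
    intro i j hi h h'
    subst hz
    exact ((hx i hi).far _ (by omega) (by omega)).1
  have pos : ∀ {i j k : ℕ}, i < j → j < k → k < 16 →
      (Cyc (z i) (z j) (z k) ↔ Cyc (z 0) (z 1) (z 2)) := by
    intro i j k hij hjk hk
    subst hz
    exact hG.cyc_iff_base hy (by omega) (by omega) (by omega) (by omega) (by omega) (by omega)
      (by omega) (by omega) (by omega)
  have posx : ∀ {i : ℕ}, i < 16 → (Cyc (z i) (x i) (z (i + 1)) ↔ Cyc (z 0) (z 1) (z 2)) := by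
    intro i hi
    have key : ∀ k, i + 1 < k → k < i + 16 →
        (Cyc (x i) (z (i + 1)) (z (i + 16)) ↔ Cyc (z (i + 1)) (z k) (z (i + 16))) := by
      intro k hk hk'
      subst hz
      exact (hG.cyc_iff hy (j := 5 * (i + 1) + 2) (k := 5 * k + 2) (l := 5 * (i + 16) + 2) (hx i hi)
        (by omega) (by omega) (by omega) (by omega)).2.1
    have hper : z (i + 16) = z i := by
      subst hz
      exact (congrArg y (by ring)).trans (hy.periodic (5 * i + 2))
    rw [hper] at key
    rw [cyc_rotate]
    rcases lt_or_ge i 14 with h | h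
    · rw [key (i + 2) (by omega) (by omega), ← cyc_rotate]
      exact pos (by omega) (by omega) (by omega)
    obtain rfl | rfl : i = 14 ∨ i = 15 := by omega
    · rw [key 16 (by omega) (by omega), z16, cyc_rotate]
      exact pos (by omega) (by omega) (by omega)
    · have z17 : z 17 = z 1 := by
        subst hz; exact hy.periodic 7
      rw [key 17 (by omega) (by omega), z17, z16]
      exact pos (by omega) (by omega) (by omega)
  by_cases hpos : Cyc (z 0) (z 1) (z 2)
  · have oriented : ∀ i ∈ ({0, 8} : Set ℕ), ¬ z i < z (i + 4) := by
      intro i hi hlt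
      have hi' : i < 12 := by rcases hi with rfl | rfl <;> omega
      obtain ⟨a₁, a₂, a₃, a₄⟩ := hodd i hi
      obtain ⟨h₁, h₂, h₃⟩ := lt_lt_lt_of_cyc hlt
        ((pos (by omega) (by omega) (by omega)).2 hpos)
        ((pos (by omega) (by omega) (by omega)).2 hpos)
        ((pos (by omega) (by omega) (by omega)).2 hpos)
        ((posx (by omega)).2 hpos) ((posx (by omega)).2 hpos)
        ((posx (by omega)).2 hpos) ((posx (by omega)).2 hpos)
      exact a₄ (hG.adj_of_nest h₁ h₂ h₃ a₁ a₂ a₃)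
    rcases lt_or_lt_of_cyc ((pos (i := 0) (j := 4) (k := 8) (by omega) (by omega) (by omega)).2 hpos)
      ((pos (i := 0) (j := 8) (k := 12) (by omega) (by omega) (by omega)).2 hpos) with h | h
    · exact oriented 0 (by simp) h
    · exact oriented 8 (by simp) h
  · have neg : ∀ {i j k : ℕ}, i < j → j < k → k < 16 → Cyc (z k) (z j) (z i) := fun hi hj hk =>
      (not_cyc_iff (zne hi (by omega)) (zne hj (by omega)) (zne (hi.trans hj) (by omega))).1
        (mt (pos hi hj hk).1 hpos)
    have neg16 : ∀ {i j k : ℕ}, 0 < i → i < j → j < k → k ≤ 16 →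
        Cyc (z k) (z j) (z i) := by
      intro i j k hi hij hjk hk
      rcases hk.lt_or_eq with hk | rfl
      · exact neg hij hjk hk
      · rw [z16, cyc_rotate]
        exact neg hi hij hjk
    have negx : ∀ {i : ℕ}, i < 16 → Cyc (z (i + 1)) (x i) (z i) := by
      intro i hi
      have hper : z (i + 16) = z i := by
        subst hz
        exact (congrArg y (by ring)).trans (hy.periodic (5 * i + 2))
      refine (not_cyc_iff ?_ (xzne hi (by omega) (by omega)) (zne (by omega) (by omega))).1
        (mt (posx hi).1 hpos)
      rw [← hper]
      exact (xzne hi (by omega) (by omega)).symm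
    have oriented : ∀ i ∈ ({4, 12} : Set ℕ), ¬ z (i + 4) < z i := by
      intro i hi hlt
      have hi' : 0 < i ∧ i ≤ 12 := by rcases hi with rfl | rfl <;> omega
      obtain ⟨a₁, a₂, a₃, a₄⟩ := heven i hi
      obtain ⟨h₁, h₂, h₃⟩ := lt_lt_lt_of_cyc hlt
        (neg16 (i := i) (j := i + 3) (k := i + 4) (by omega) (by omega) (by omega) (by omega))
        (neg16 (i := i) (j := i + 2) (k := i + 3) (by omega) (by omega) (by omega) (by omega))
        (neg16 (i := i) (j := i + 1) (k := i + 2) (by omega) (by omega) (by omega) (by omega))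
        (negx (by omega)) (negx (by omega)) (negx (by omega)) (negx (by omega))
      exact a₄ (hG.adj_of_nest h₁ h₂ h₃ a₁ a₂ a₃)
    rcases lt_or_lt_of_cyc (p := z 8) (q := z 4) (r := z 0) (s := z 12)
      (neg (by omega) (by omega) (by omega))
      (cyc_rotate.1 (neg (i := 0) (j := 8) (k := 12) (by omega) (by omega) (by omega))) with h | h
    · exact oriented 4 (by simp) h
    · exact oriented 12 (by simp) (z16 ▸ h)

end IsGroundedLOrder

/-! ### The graph of Jelínek and Töpfer -/

instance : DecidableRel jelinekTopferRel := fun u v => by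
  cases u <;> cases v <;> unfold jelinekTopferRel <;> infer_instance

instance : DecidableRel jelinekTopferGraph.Adj := fun u v =>
  inferInstanceAs (Decidable (u ≠ v ∧ (jelinekTopferRel u v ∨ jelinekTopferRel v u)))

theorem isInducedCycle_jelinekTopferGraph :
    IsInducedCycle jelinekTopferGraph 80 fun n => Sum.inl (Fin.ofNat 80 n) where
  periodic n := by simp [Fin.ofNat]
  adj n := by
    simp only [jelinekTopferGraph, SimpleGraph.fromRel_adj, jelinekTopferRel, ne_eq,
      Sum.inl.injEq, Fin.ext_iff, Fin.ofNat, Fin.val_add]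
    norm_num
    omega
  far m n h₁ h₂ := by
    simp only [jelinekTopferGraph, SimpleGraph.fromRel_adj, jelinekTopferRel, ne_eq,
      Sum.inl.injEq, Fin.ext_iff, Fin.ofNat, Fin.val_add]
    norm_num
    omega

theorem isAttached_jelinekTopferGraph {i : ℕ} (_ : i < 16) :
    IsAttached jelinekTopferGraph 80 (fun n => Sum.inl (Fin.ofNat 80 n))
      (Sum.inr (Fin.ofNat 16 i)) (5 * i + 4) where
  eq_or_adj := by
    right
    simp only [jelinekTopferGraph, SimpleGraph.fromRel_adj, jelinekTopferRel, ne_eq, Fin.ofNat,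
      reduceCtorEq, not_false_eq_true, true_and, or_false]
    omega
  far m h₁ h₂ := by
    simp only [jelinekTopferGraph, SimpleGraph.fromRel_adj, jelinekTopferRel, ne_eq, Fin.ofNat,
      reduceCtorEq, not_false_eq_true, true_and, or_false]
    omega

theorem not_exists_clockwise_jelinekTopferGraph {R : Fin 80 ⊕ Fin 16 → GroundedL}
    (hR : IsGroundedLRepresentation jelinekTopferGraph R) : ¬ ∀ v, (R v).TurnsClockwise := by
  intro hcw
  obtain ⟨_, hG⟩ := exists_isGroundedLOrder hR hcw
  refine hG.false_of_gadgets isInducedCycle_jelinekTopferGraph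
    (x := fun i => Sum.inr (Fin.ofNat 16 i)) (fun i hi => isAttached_jelinekTopferGraph hi) ?_ ?_
  · rintro i (rfl | rfl) <;> decide
  · rintro i (rfl | rfl) <;> decide

theorem not_isOneSided_jelinekTopferGraph {R : Fin 80 ⊕ Fin 16 → GroundedL}
    (hR : IsGroundedLRepresentation jelinekTopferGraph R) : ¬ IsOneSided R := by
  rintro (h | h)
  · exact not_exists_clockwise_jelinekTopferGraph hR h
  · refine not_exists_clockwise_jelinekTopferGraph (R := fun v => (R v).mirror)
      (fun u v huv => (hR u v huv).trans GroundedL.mirror_inter_nonempty_iff.symm) fun v => ?_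
    exact neg_pos.2 (h v)

/-- Abscissae of the feet in a 2-sided representation by squares. -/
def squareFoot : Fin 80 ⊕ Fin 16 → ℤ
  | Sum.inl j => if j = 0 then 54600 else if j = 1 then 300 else 700 * ((j : ℕ) : ℤ) - 1400
  | Sum.inr i => 3500 * ((i : ℕ) : ℤ) + 1900

/-- Heights in a 2-sided representation by squares. -/
def squareHeight : Fin 80 ⊕ Fin 16 → ℤ
  | Sum.inl j => if j = 0 then 54500 else if j = 1 then 54400 else 1000 + ((j : ℕ) : ℤ)
  | Sum.inr i => 5 * ((i / 4 : ℕ) : ℤ) +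
      ![10700, 3600, 3550, 10600, 10600, 3550, 3600, 10700] (Fin.ofNat 8 i)

/-- Directions of the horizontal segments in a 2-sided representation by squares. -/
def squareSign : Fin 80 ⊕ Fin 16 → ℤ
  | Sum.inl _ => 1
  | Sum.inr i => ![1, -1, -1, -1, 1, 1, 1, -1] (Fin.ofNat 8 i)

/-- The horizontal segment of `u` meets the vertical segment of `v`, in integer coordinates. -/
def SquareHits (u v : Fin 80 ⊕ Fin 16) : Prop :=
  squareHeight u ≤ squareHeight v ∧
    ((squareFoot u ≤ squareFoot v ∧
        squareFoot v ≤ squareFoot u + squareSign u * squareHeight u) ∨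
      (squareFoot u + squareSign u * squareHeight u ≤ squareFoot v ∧ squareFoot v ≤ squareFoot u))

instance : DecidableRel SquareHits := fun u v => by
  unfold SquareHits; infer_instance

theorem squareHeight_pos (v : Fin 80 ⊕ Fin 16) : 0 < squareHeight v := by
  revert v; decide +kernel

theorem squareSign_eq (v : Fin 80 ⊕ Fin 16) : squareSign v = 1 ∨ squareSign v = -1 := by
  revert v; decide +kernel

theorem square_generalPosition (u v : Fin 80 ⊕ Fin 16) (h : u ≠ v) :
    squareFoot u ≠ squareFoot v ∧ squareHeight u ≠ squareHeight v := by
  revert u v; decide +kernel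

theorem adj_iff_squareHits (u v : Fin 80 ⊕ Fin 16) (h : u ≠ v) :
    jelinekTopferGraph.Adj u v ↔ SquareHits u v ∨ SquareHits v u := by
  revert u v; decide +kernel

/-- A 2-sided representation of the graph of Jelínek and Töpfer by squares. -/
noncomputable def squareRepresentation (v : Fin 80 ⊕ Fin 16) : GroundedL where
  foot := squareFoot v
  height := squareHeight v
  arm := squareSign v * squareHeight v
  height_pos := Int.cast_pos.2 (squareHeight_pos v)
  arm_ne_zero := by
    have := squareHeight_pos v
    rcases squareSign_eq v with h | h <;> rw [h] <;> norm_num <;> omega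

theorem squareRepresentation_hits_iff (u v : Fin 80 ⊕ Fin 16) :
    (squareRepresentation u).Hits (squareRepresentation v) ↔ SquareHits u v := by
  simp only [GroundedL.Hits, SquareHits, squareRepresentation, Set.mem_uIcc]
  norm_cast

theorem theorem6 :
    (∃ R : Fin 80 ⊕ Fin 16 → GroundedL,
      IsGroundedLRepresentation jelinekTopferGraph R ∧ IsTwoSided R ∧
        (∀ v, (R v).IsSquare) ∧ InGeneralPosition R) ∧
    ¬ ∃ R : Fin 80 ⊕ Fin 16 → GroundedL,
      IsGroundedLRepresentation jelinekTopferGraph R ∧ IsOneSided R := by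
  have hpos : InGeneralPosition squareRepresentation := fun u v h =>
    (square_generalPosition u v h).imp (mt Int.cast_inj.1) (mt Int.cast_inj.1)
  have hrep : IsGroundedLRepresentation jelinekTopferGraph squareRepresentation := by
    intro u v h
    rw [GroundedL.inter_nonempty_iff (Or.inl (hpos u v h).2), adj_iff_squareHits u v h,
      squareRepresentation_hits_iff, squareRepresentation_hits_iff]
  refine ⟨⟨squareRepresentation, hrep, not_isOneSided_jelinekTopferGraph hrep, fun v => ?_, hpos⟩,
    fun ⟨R, hR, h⟩ => not_isOneSided_jelinekTopferGraph hR h⟩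
  have h : (0 : ℝ) < squareHeight v := Int.cast_pos.2 (squareHeight_pos v)
  rcases squareSign_eq v with h' | h' <;>
    simp [GroundedL.IsSquare, squareRepresentation, h', abs_of_pos h]
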